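/- Let $\mathcal{D}$ be any probability distribution on $\mathbb{R}^d\times[k]$ (features and labels), let $(X,Y)\sim\mathcal{D}$, and let $\mathcal{A}:\mathbb{R}^d\to\mathbb{R}^d$ be a fixed (measurable) input-dependent adversarial attack, with $\mathcal{A}(X)\neq 0$ almost surely. Let $$M=\mathbb{E}\left[\frac{\mathcal{A}(X)}{\|\mathcal{A}(X)\|}\frac{\mathcal{A}(X)^T}{\|\mathcal{A}(X)\|}\right]\in\mathbb{R}^{d\times d},$$ let $\lambda=\|M\|$ (spectral norm) be its top eigenvalue, $v$ a corresponding unit eigenvector, and $r=\operatorname{tr}(M)/\|M\|$ its intrinsic dimension. Suppose that the gap between $\lambda$ and the second eigenvalue of $M$ (counted with multiplicity) is at least $\gamma\lambda$, and let $0<\epsilon<\gamma$ (for $d=1$ there is no second eigenvalue and the gap condition is void). Let $X_1,\dots,X_m$ be i.i.d. samples of $X$, let $$\tilde M=\frac1m\sum_{i=1}^m\frac{\mathcal{A}(X_i)}{\|\mathcal{A}(X_i)\|}\frac{\mathcal{A}(X_i)^T}{\|\mathcal{A}(X_i)\|},$$ and let $\tilde v$ be any unit eigenvector of $\tilde M$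 for its top eigenvalue $\tilde\lambda=\|\tilde M\|$. Then there is an absolute constant $C>0$ such that: (i) if $m\ge C\,\epsilon^{-2}\,r\log d$, then with probability at least $2/3$, $\min_{s\in\{1,-1\}}\|v-s\,\tilde v\|\le\epsilon/\gamma$ for every choice of $\tilde v$; (ii) for every $0<\delta<1$, if $m\ge C\,\epsilon^{-2}\,r\,(\log d+\log(1/\delta))$, then the same holds with probability at least $1-\delta$. -/

import Mathlib

open MeasureTheory ProbabilityTheory

namespace UniversalAttack

/-- The spectral (`ℓ₂ → ℓ₂` operator) norm of a real square matrix. -/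
noncomputable def specNorm {d : ℕ} (A : Matrix (Fin d) (Fin d) ℝ) : ℝ :=
  ‖Matrix.toEuclideanCLM (n := Fin d) (𝕜 := ℝ) A‖

/-- `v` is a unit eigenvector of `A` for the eigenvalue `‖A‖` (for a positive semidefinite `A`, this
is the top eigenvalue). -/
def IsTopEigenvector {d : ℕ} (A : Matrix (Fin d) (Fin d) ℝ) (v : EuclideanSpace ℝ (Fin d)) : Prop :=
  ‖v‖ = 1 ∧ Matrix.toEuclideanCLM (n := Fin d) (𝕜 := ℝ) A v = specNorm A • v

/-- The intrinsic dimension `tr A / ‖A‖`. -/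
noncomputable def intrinsicDim {d : ℕ} (A : Matrix (Fin d) (Fin d) ℝ) : ℝ :=
  A.trace / specNorm A

/-- The distance from `‖A‖` down to the second eigenvalue of `A` is at least `g`. The family
`eigenvalues₀` lists the eigenvalues with multiplicity in decreasing order, starting at index `0`;
so the entries with index `≥ 1` are the second eigenvalue and those below it. -/
def HasTopEigengap {d : ℕ} (A : Matrix (Fin d) (Fin d) ℝ) (hA : A.IsHermitian) (g : ℝ) : Prop :=
  ∀ i : Fin (Fintype.card (Fin d)), 1 ≤ (i : ℕ) → g ≤ specNorm A - hA.eigenvalues₀ i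

/-- The attack direction `𝒜(x) / ‖𝒜(x)‖`. -/
noncomputable def attackDir {d : ℕ} (𝒜 : EuclideanSpace ℝ (Fin d) → EuclideanSpace ℝ (Fin d))
    (x : EuclideanSpace ℝ (Fin d)) : EuclideanSpace ℝ (Fin d) :=
  ‖𝒜 x‖⁻¹ • 𝒜 x

/-- The matrix `M`: the expectation, for `(X, Y)` drawn from `D`, of the outer product of the attack
direction at `X` with itself (entry by entry). -/
noncomputable def attackMatrix {d k : ℕ} (D : Measure (EuclideanSpace ℝ (Fin d) × Fin k))
    (𝒜 : EuclideanSpace ℝ (Fin d) → EuclideanSpace ℝ (Fin d)) : Matrix (Fin d) (Fin d) ℝ :=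
  Matrix.of fun i j => ∫ z, attackDir 𝒜 z.1 i * attackDir 𝒜 z.1 j ∂D

/-- The matrix `M̃`: the average of the outer products of the attack directions over the sample
`x 0, …, x (m - 1)`. -/
noncomputable def empiricalAttackMatrix {d m : ℕ}
    (𝒜 : EuclideanSpace ℝ (Fin d) → EuclideanSpace ℝ (Fin d))
    (x : Fin m → EuclideanSpace ℝ (Fin d)) : Matrix (Fin d) (Fin d) ℝ :=
  (1 / (m : ℝ)) • ∑ l, Matrix.vecMulVec (attackDir 𝒜 (x l)).ofLp (attackDir 𝒜 (x l)).ofLp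

theorem attackMatrix_isHermitian {d k : ℕ} (D : Measure (EuclideanSpace ℝ (Fin d) × Fin k))
    (𝒜 : EuclideanSpace ℝ (Fin d) → EuclideanSpace ℝ (Fin d)) :
    (attackMatrix D 𝒜).IsHermitian := by
  ext i j
  simp [attackMatrix, mul_comm]

end UniversalAttack

/-! The directions `u = attackDir 𝒜 X` are almost surely unit vectors, so `M = E[u uᵀ]` has trace 1
and the intrinsic dimension is `1/λ`. Two facts combine.

Perturbation: if the quadratic form of `M̃ - M` is at most `ελ/3` on unit vectors, a Davis–Kahan
argument with gap `γλ` (`norm_sub_le_or_norm_add_le_of_eigengap`) places the top eigenvectors within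
`ε/γ` up to sign.

Concentration: `E(u uᵀ - M)² ≤ M ≤ λ` in the Loewner order, so a matrix Bernstein bound
(`IsSecondMoment.measure_exists_le_sum_le`) makes the failure probability at most `2d
exp(-mλε²/36)`; the variance `λ`, rather than 1, is what brings `r` into the sample size. Bernstein
follows from Markov's inequality for `tr exp` of the sum, the summands being split off one at a time
(Ahlswede–Winter) by Golden–Thompson, `tr exp(A+B) ≤ tr(exp A exp B)`. The latter is the limit, by
Lie–Trotter, of `tr (AB)^(2^k) ≤ tr(A^(2^k) B^(2^k))` for symmetric matrices. -/

namespace UniversalAttack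

/-! ### Trace inequalities for powers of products of symmetric matrices. -/

section TraceInequalities

open Matrix

variable {n : Type*} [Fintype n] [DecidableEq n]

theorem trace_mul_nonneg {A B : Matrix n n ℝ} (hA : A.PosSemidef) (hB : B.PosSemidef) :
    0 ≤ (A * B).trace := by
  open scoped MatrixOrder in
  obtain ⟨R, rfl⟩ := CStarAlgebra.nonneg_iff_eq_star_mul_self.mp hA.nonneg
  rw [Matrix.mul_assoc, trace_mul_comm, star_eq_conjTranspose]
  exact (hB.mul_mul_conjTranspose_same R).trace_nonneg

/-- The AM–GM inequality for the Frobenius inner product: expand `‖A - Bᴴ‖² ≥ 0`. -/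
theorem trace_mul_le_half (A B : Matrix n n ℝ) :
    (A * B).trace ≤ ((A * Aᴴ).trace + (B * Bᴴ).trace) / 2 := by
  have h := (posSemidef_self_mul_conjTranspose (A - Bᴴ)).trace_nonneg
  have e : (A - Bᴴ) * (A - Bᴴ)ᴴ = A * Aᴴ - A * B - (A * B)ᴴ + Bᴴ * B := by
    rw [conjTranspose_sub, conjTranspose_conjTranspose, conjTranspose_mul]; noncomm_ring
  rw [e, trace_add, trace_sub, trace_sub, trace_conjTranspose, trace_mul_comm Bᴴ B] at h
  simp only [star_trivial] at h
  linarith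

theorem trace_mul_pow_comm (A B : Matrix n n ℝ) (k : ℕ) :
    ((A * B) ^ k).trace = ((B * A) ^ k).trace := by
  cases k with
  | zero => simp
  | succ k =>
    have h : SemiconjBy B (A * B) (B * A) := by simp [SemiconjBy, mul_assoc]
    rw [pow_succ', pow_succ, mul_assoc, trace_mul_comm, (h.pow_right k).eq, mul_assoc]

/-- Applying `h` to `Z = AB` and cycling the trace replaces `A, B` by `A², B²` while halving the
outer exponent. Only `j < k` is assumed, so that the strong induction in `trace_pow_two_pow_le` can
call this lemma. -/
theorem trace_mul_pow_two_pow_le_of {k : ℕ}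
    (h : ∀ j < k, ∀ Z : Matrix n n ℝ, (Z ^ 2 ^ (j + 1)).trace ≤ ((Z * Zᴴ) ^ 2 ^ j).trace)
    {A B : Matrix n n ℝ} (hA : A.IsHermitian) (hB : B.IsHermitian) :
    ((A * B) ^ 2 ^ k).trace ≤ (A ^ 2 ^ k * B ^ 2 ^ k).trace := by
  induction k generalizing A B with
  | zero => simp
  | succ k ih =>
    have e : A * B * (A * B)ᴴ = A * (B * B * A) := by
      rw [conjTranspose_mul, hA.eq, hB.eq]; noncomm_ring
    have e' : B * B * A * A = B ^ 2 * A ^ 2 := by noncomm_ring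
    calc ((A * B) ^ 2 ^ (k + 1)).trace ≤ ((A * B * (A * B)ᴴ) ^ 2 ^ k).trace := h k (by simp) _
      _ = ((A ^ 2 * B ^ 2) ^ 2 ^ k).trace := by
        rw [e, trace_mul_pow_comm, e', trace_mul_pow_comm]
      _ ≤ ((A ^ 2) ^ 2 ^ k * (B ^ 2) ^ 2 ^ k).trace :=
        ih (fun j hj => h j (by omega)) (hA.pow 2) (hB.pow 2)
      _ = _ := by rw [← pow_mul, ← pow_mul, ← pow_succ']

theorem trace_pow_two_pow_le (k : ℕ) (Z : Matrix n n ℝ) :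
    (Z ^ 2 ^ (k + 1)).trace ≤ ((Z * Zᴴ) ^ 2 ^ k).trace := by
  induction k using Nat.strong_induction_on generalizing Z with
  | _ k ih =>
    cases k with
    | zero =>
      have := trace_mul_le_half Z Z
      simp only [zero_add, pow_one, pow_zero, sq]
      linarith
    | succ k =>
      have hL := isHermitian_mul_conjTranspose_self Z
      have hR := isHermitian_conjTranspose_mul_self Z
      have e : Z ^ 2 * (Z ^ 2)ᴴ = Z * (Z * Zᴴ * Zᴴ) := by
        rw [sq, conjTranspose_mul]; noncomm_ring
      have e' : Z * Zᴴ * Zᴴ * Z = (Z * Zᴴ) * (Zᴴ * Z) := by noncomm_ring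
      -- The induction hypothesis for `Z²` produces, up to cyclic order, the product of the
      -- symmetric matrices `ZZᴴ` and `ZᴴZ`. These are separated by the previous lemma and then by
      -- AM–GM, and their powers have equal traces.
      calc (Z ^ 2 ^ (k + 1 + 1)).trace = ((Z ^ 2) ^ 2 ^ (k + 1)).trace := by
            rw [← pow_mul, ← pow_succ']
        _ ≤ ((Z ^ 2 * (Z ^ 2)ᴴ) ^ 2 ^ k).trace := ih k (by simp) _
        _ = (((Z * Zᴴ) * (Zᴴ * Z)) ^ 2 ^ k).trace := by rw [e, trace_mul_pow_comm, e']
        _ ≤ ((Z * Zᴴ) ^ 2 ^ k * (Zᴴ * Z) ^ 2 ^ k).trace :=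
          trace_mul_pow_two_pow_le_of (fun j hj => ih j (by omega)) hL hR
        _ ≤ _ := trace_mul_le_half _ _
        _ = ((Z * Zᴴ) ^ 2 ^ (k + 1)).trace := by
          rw [(hL.pow _).eq, (hR.pow _).eq, ← pow_add, ← pow_add, ← mul_two, ← pow_succ,
            trace_mul_pow_comm Zᴴ Z]
          ring

theorem trace_mul_pow_two_pow_le (k : ℕ) {A B : Matrix n n ℝ} (hA : A.IsHermitian)
    (hB : B.IsHermitian) : ((A * B) ^ 2 ^ k).trace ≤ (A ^ 2 ^ k * B ^ 2 ^ k).trace :=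
  trace_mul_pow_two_pow_le_of (fun j _ => trace_pow_two_pow_le j) hA hB

end TraceInequalities

/-! ### The Lie–Trotter product formula in a Banach algebra. -/

section LieTrotter

open Filter Topology NormedSpace

variable {𝔸 : Type*} [NormedRing 𝔸]

theorem norm_pow_sub_pow_le [NormOneClass 𝔸] {x y : 𝔸} {K : ℝ} (hx : ‖x‖ ≤ K) (hy : ‖y‖ ≤ K)
    (N : ℕ) :
    ‖x ^ (N + 1) - y ^ (N + 1)‖ ≤ (N + 1) * K ^ N * ‖x - y‖ := by
  have hK : 0 ≤ K := (norm_nonneg _).trans hx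
  induction N with
  | zero => simp
  | succ N ih =>
    have e : x ^ (N + 1 + 1) - y ^ (N + 1 + 1)
        = x * (x ^ (N + 1) - y ^ (N + 1)) + (x - y) * y ^ (N + 1) := by
      rw [pow_succ' x (N + 1), pow_succ' y (N + 1)]; noncomm_ring
    have hy' : ‖y ^ (N + 1)‖ ≤ K ^ (N + 1) :=
      (norm_pow_le y _).trans (pow_le_pow_left₀ (norm_nonneg _) hy _)
    calc _ ≤ ‖x‖ * ‖x ^ (N + 1) - y ^ (N + 1)‖ + ‖x - y‖ * ‖y ^ (N + 1)‖ := by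
          rw [e]; exact (norm_add_le _ _).trans (add_le_add (norm_mul_le _ _) (norm_mul_le _ _))
      _ ≤ K * ((N + 1) * K ^ N * ‖x - y‖) + ‖x - y‖ * K ^ (N + 1) := by gcongr
      _ = _ := by push_cast; ring

variable [NormedAlgebra ℝ 𝔸]

theorem norm_exp_le_exp_norm [NormOneClass 𝔸] (x : 𝔸) : ‖exp x‖ ≤ Real.exp ‖x‖ := by
  rw [congrFun (exp_eq_tsum ℝ) x, Real.exp_eq_exp_ℝ, congrFun (exp_eq_tsum ℝ) ‖x‖]
  refine (norm_tsum_le_tsum_norm (norm_expSeries_summable' x)).trans ?_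
  refine (norm_expSeries_summable' (𝕂 := ℝ) x).tsum_le_tsum (fun k => ?_)
    (expSeries_summable' ‖x‖)
  rw [norm_smul, norm_inv, Real.norm_natCast, smul_eq_mul]
  gcongr
  exact norm_pow_le x k

variable [CompleteSpace 𝔸]

/-- The Lie–Trotter product formula. -/
theorem tendsto_exp_mul_exp_pow [NormOneClass 𝔸] (a b : 𝔸) :
    Tendsto (fun N : ℕ => (exp ((N : ℝ)⁻¹ • a) * exp ((N : ℝ)⁻¹ • b)) ^ N) atTop
      (𝓝 (exp (a + b))) := by
  -- A zero derivative makes the one-step error `o(1/N)`; the telescoping bound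
  -- `norm_pow_sub_pow_le` multiplies it by at most `N exp(‖a‖ + ‖b‖)`.
  have hd : HasDerivAt (fun t : ℝ => exp (t • a) * exp (t • b) - exp (t • (a + b))) 0 0 := by
    have h := fun c : 𝔸 => hasDerivAt_exp_smul_const (𝕂 := ℝ) c (0 : ℝ)
    refine (((h a).mul (h b)).sub (h (a + b))).congr_deriv ?_
    simp
  have hinv : Tendsto (fun N : ℕ => (N : ℝ)⁻¹) atTop (𝓝[≠] 0) :=
    tendsto_nhdsWithin_iff.mpr ⟨tendsto_inv_atTop_nhds_zero_nat,
      (eventually_gt_atTop 0).mono fun N hN => by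
        simpa using hN.ne'⟩
  have hs := (hasDerivAt_iff_tendsto_slope.mp hd).comp hinv
  have hnorm : ∀ (c : 𝔸) (N : ℕ), ‖exp ((N : ℝ)⁻¹ • c)‖ ≤ Real.exp (‖c‖ / N) := by
    intro c N
    refine (norm_exp_le_exp_norm _).trans_eq ?_
    rw [norm_smul, norm_inv, Real.norm_natCast, inv_mul_eq_div]
  rw [tendsto_iff_norm_sub_tendsto_zero]
  have hs' := (hs.norm).const_mul (Real.exp (‖a‖ + ‖b‖))
  rw [norm_zero, mul_zero] at hs'
  refine squeeze_zero' (Eventually.of_forall fun N => norm_nonneg _) ?_ hs'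
  filter_upwards [eventually_gt_atTop 0] with N hN
  obtain ⟨N, rfl⟩ : ∃ j, N = j + 1 := ⟨N - 1, by omega⟩
  set q : ℝ := ((N + 1 : ℕ) : ℝ) with hq
  have hq0 : 0 < q := by positivity
  have hy : exp (a + b) = exp (q⁻¹ • (a + b)) ^ (N + 1) := by
    let _ : NormedAlgebra ℚ 𝔸 := NormedAlgebra.restrictScalars ℚ ℝ 𝔸
    rw [← exp_nsmul, ← Nat.cast_smul_eq_nsmul ℝ, smul_smul, mul_inv_cancel₀ hq0.ne', one_smul]
  have hK1 : ‖exp (q⁻¹ • a) * exp (q⁻¹ • b)‖ ≤ Real.exp ((‖a‖ + ‖b‖) / q) := by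
    rw [add_div, Real.exp_add]
    exact (norm_mul_le _ _).trans (mul_le_mul (hnorm a _) (hnorm b _) (norm_nonneg _) (by positivity))
  have hK2 : ‖exp (q⁻¹ • (a + b))‖ ≤ Real.exp ((‖a‖ + ‖b‖) / q) :=
    (hnorm _ _).trans (Real.exp_le_exp.mpr (by gcongr; exact norm_add_le _ _))
  rw [hy]
  refine (norm_pow_sub_pow_le hK1 hK2 N).trans ?_
  have hKN : Real.exp ((‖a‖ + ‖b‖) / q) ^ N ≤ Real.exp (‖a‖ + ‖b‖) := by
    rw [← Real.exp_nat_mul]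
    refine Real.exp_le_exp.mpr ?_
    rw [mul_div_assoc', div_le_iff₀ hq0, mul_comm]
    gcongr
    simp [hq]
  have hslope : ‖slope (fun t : ℝ => exp (t • a) * exp (t • b) - exp (t • (a + b))) 0 q⁻¹‖
      = q * ‖exp (q⁻¹ • a) * exp (q⁻¹ • b) - exp (q⁻¹ • (a + b))‖ := by
    simp [slope_def_module, norm_smul, abs_of_pos hq0]
  have hqN : q = N + 1 := by rw [hq]; push_cast; rfl
  rw [Function.comp_apply]
  change _ ≤ Real.exp (‖a‖ + ‖b‖) * ‖slope _ 0 q⁻¹‖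
  rw [hslope]
  calc _ ≤ (N + 1) * Real.exp (‖a‖ + ‖b‖)
        * ‖exp (q⁻¹ • a) * exp (q⁻¹ • b) - exp (q⁻¹ • (a + b))‖ := by gcongr
    _ = _ := by rw [hqN]; ring

end LieTrotter

/-! ### Golden–Thompson and spectral inequalities for the matrix exponential. -/

section MatrixExp

open Matrix Filter Topology NormedSpace

variable {n : Type*} [Fintype n] [DecidableEq n]

attribute [local instance] Matrix.linftyOpNormedRing Matrix.linftyOpNormedAlgebra

theorem continuous_matrix_exp : Continuous (exp : Matrix n n ℝ → Matrix n n ℝ) :=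
  exp_continuous

theorem matrix_tendsto_exp_mul_exp_pow (A B : Matrix n n ℝ) :
    Tendsto (fun N : ℕ => (exp ((N : ℝ)⁻¹ • A) * exp ((N : ℝ)⁻¹ • B)) ^ N) atTop
      (𝓝 (exp (A + B))) := by
  -- For empty `n` the matrix ring is trivial and `‖1‖ = 0`, so `NormOneClass` needs `n` nonempty.
  cases isEmpty_or_nonempty n
  · exact tendsto_const_nhds.congr fun N => Subsingleton.elim _ _
  · have : NormOneClass (Matrix n n ℝ) := Matrix.linfty_opNormOneClass
    exact tendsto_exp_mul_exp_pow A B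

/-- The Golden–Thompson inequality for real symmetric matrices. -/
theorem trace_exp_add_le {A B : Matrix n n ℝ} (hA : A.IsHermitian) (hB : B.IsHermitian) :
    (exp (A + B)).trace ≤ (exp A * exp B).trace := by
  -- The trace inequality covers exponents `2^k` only, so the limit is taken along this subsequence.
  have h2 : Tendsto (fun k : ℕ => 2 ^ k) atTop (atTop : Filter ℕ) :=
    tendsto_pow_atTop_atTop_of_one_lt (by norm_num)
  have hT := ((Continuous.matrix_trace continuous_id).tendsto _).comp
    ((matrix_tendsto_exp_mul_exp_pow A B).comp h2)
  refine le_of_tendsto hT (Eventually.of_forall fun k => ?_)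
  have hexp : ∀ C : Matrix n n ℝ, exp (((2 ^ k : ℕ) : ℝ)⁻¹ • C) ^ 2 ^ k = exp C := fun C => by
    rw [← Matrix.exp_nsmul, ← Nat.cast_smul_eq_nsmul ℝ, smul_smul, mul_inv_cancel₀ (by positivity),
      one_smul]
  have hh : ∀ {C : Matrix n n ℝ}, C.IsHermitian → (exp (((2 ^ k : ℕ) : ℝ)⁻¹ • C)).IsHermitian :=
    fun hC => IsHermitian.exp (by rw [IsHermitian, conjTranspose_smul, hC.eq, star_trivial])
  have := trace_mul_pow_two_pow_le k (hh hA) (hh hB)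
  rwa [hexp, hexp] at this

/-- A scalar inequality for a quadratic polynomial in `x` and `exp x` on the spectrum of a symmetric
matrix holds for the matrix. -/
theorem posSemidef_exp_quadratic {A : Matrix n n ℝ} (hA : A.IsHermitian) (s a b c : ℝ)
    (h : ∀ i, 0 ≤ s * Real.exp (hA.eigenvalues i) + a + b * hA.eigenvalues i
      + c * hA.eigenvalues i ^ 2) :
    (s • exp A + a • 1 + b • A + c • A ^ 2).PosSemidef := by
  set U : Matrix n n ℝ := (hA.eigenvectorUnitary : Matrix n n ℝ)
  set D : Matrix n n ℝ := diagonal hA.eigenvalues with hD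
  have hUU : U * Uᴴ = 1 := (Unitary.mem_iff.mp hA.eigenvectorUnitary.2).2
  have hUU' : Uᴴ * U = 1 := (Unitary.mem_iff.mp hA.eigenvectorUnitary.2).1
  have hinv : U⁻¹ = Uᴴ := inv_eq_right_inv hUU
  have hA' : A = U * D * Uᴴ := by
    conv_lhs => rw [hA.spectral_theorem]
    rfl
  have hexp : exp A = U * exp D * Uᴴ := by
    rw [hA', ← hinv, Matrix.exp_conj U D (IsUnit.of_mul_eq_one _ hUU)]
  have hsq : A ^ 2 = U * D ^ 2 * Uᴴ := by
    rw [hA', sq, sq]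
    calc U * D * Uᴴ * (U * D * Uᴴ) = U * D * (Uᴴ * U) * D * Uᴴ := by noncomm_ring
      _ = _ := by rw [hUU']; noncomm_ring
  have e : s • exp A + a • 1 + b • A + c • A ^ 2
      = U * (s • exp D + a • 1 + b • D + c • D ^ 2) * Uᴴ := by
    rw [hexp, hsq]
    conv_lhs => rw [← hUU, hA']
    simp [mul_add, add_mul]
  rw [e]
  refine PosSemidef.mul_mul_conjTranspose_same ?_ U
  have e2 : s • exp D + a • 1 + b • D + c • D ^ 2 = diagonal fun i =>
      s * Real.exp (hA.eigenvalues i) + a + b * hA.eigenvalues i + c * hA.eigenvalues i ^ 2 := by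
    rw [hD, Matrix.exp_diagonal, diagonal_pow]
    ext i j
    by_cases hij : i = j
    · subst hij; simp [Real.exp_eq_exp_ℝ, Pi.coe_exp]
    · simp [hij]
  rw [e2]
  exact PosSemidef.diagonal h

theorem posSemidef_exp {A : Matrix n n ℝ} (hA : A.IsHermitian) : (exp A).PosSemidef := by
  simpa using posSemidef_exp_quadratic hA 1 0 0 0 fun i => by simpa using (Real.exp_pos _).le

theorem abs_eigenvalues_le {A : Matrix n n ℝ} (hA : A.IsHermitian) {r : ℝ}
    (h : ∀ x : n → ℝ, |x ⬝ᵥ A *ᵥ x| ≤ r * (x ⬝ᵥ x)) (i : n) : |hA.eigenvalues i| ≤ r := by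
  have h1 := h (hA.eigenvectorBasis i)
  have h2 : (hA.eigenvectorBasis i).ofLp ⬝ᵥ (hA.eigenvectorBasis i).ofLp = 1 := by
    have := hA.eigenvectorBasis.orthonormal.1 i
    have h3 := real_inner_self_eq_norm_sq (hA.eigenvectorBasis i)
    rw [this, EuclideanSpace.inner_eq_star_dotProduct] at h3
    simpa using h3
  rw [h2, mul_one] at h1
  simpa [hA.eigenvalues_eq i] using h1

theorem posSemidef_quadratic_sub_exp {A : Matrix n n ℝ} (hA : A.IsHermitian)
    (h : ∀ x : n → ℝ, |x ⬝ᵥ A *ᵥ x| ≤ x ⬝ᵥ x) : (1 + A + A ^ 2 - exp A).PosSemidef := by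
  convert posSemidef_exp_quadratic hA (-1) 1 1 1 fun i => ?_ using 1
  · simp; abel
  -- The scalar source is `exp t ≤ 1 + t + t²` for `|t| ≤ 1`.
  · have := (abs_le.mp (Real.abs_exp_sub_one_sub_id_le
      (abs_eigenvalues_le hA (r := 1) (by simpa using h) i))).2
    linarith

/-- The tangent line of `exp` at `c` gives `xᵀ exp(A) x ≥ exp(c) (1 + xᵀAx - c) ≥ exp c`, and `xᵀ
exp(A) x ≤ tr exp A` because `1 - x xᵀ` is positive semidefinite. This turns a large quadratic form
into a large trace, ready for Markov's inequality. -/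
theorem exp_le_trace_exp {A : Matrix n n ℝ} (hA : A.IsHermitian) {x : n → ℝ} {c : ℝ}
    (hx : x ⬝ᵥ x = 1) (hc : c ≤ x ⬝ᵥ A *ᵥ x) : Real.exp c ≤ (exp A).trace := by
  have h1 : (exp A + (Real.exp c * (c - 1)) • 1 + (-Real.exp c) • A).PosSemidef := by
    simpa using posSemidef_exp_quadratic hA 1 (Real.exp c * (c - 1)) (-Real.exp c) 0 fun i => by
      have h := Real.add_one_le_exp (hA.eigenvalues i - c)
      have h' : Real.exp (hA.eigenvalues i) = Real.exp c * Real.exp (hA.eigenvalues i - c) := by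
        rw [← Real.exp_add]; ring_nf
      rw [h']
      nlinarith [Real.exp_pos c]
  have h2 := h1.dotProduct_mulVec_nonneg x
  simp only [add_mulVec, smul_mulVec, dotProduct_add, dotProduct_smul, star_trivial, one_mulVec,
    hx, smul_eq_mul] at h2
  have h3 : x ⬝ᵥ exp A *ᵥ x ≤ (exp A).trace := by
    have hP : (1 - vecMulVec x x).PosSemidef := by
      refine PosSemidef.of_dotProduct_mulVec_nonneg ?_ fun y => ?_
      · ext i j; simp [vecMulVec_apply, mul_comm, one_apply, eq_comm]
      · have : (x ⬝ᵥ y) ^ 2 ≤ (x ⬝ᵥ x) * (y ⬝ᵥ y) := by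
          simpa [dotProduct, sq] using Finset.sum_mul_sq_le_sq_mul_sq Finset.univ x y
        rw [hx, one_mul] at this
        simp only [sub_mulVec, dotProduct_sub, one_mulVec, vecMulVec_mulVec, star_trivial,
          dotProduct_smul]
        rw [dotProduct_comm y x]
        simp
        linarith
    have := trace_mul_nonneg (posSemidef_exp hA) hP
    rw [mul_sub, mul_one, trace_sub, mul_vecMulVec, trace_vecMulVec] at this
    rw [dotProduct_comm]
    linarith
  nlinarith [Real.exp_pos c]

end MatrixExp

/-! ### Matrix Bernstein inequality for rank-one samples. -/

section MatrixConcentration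

open Matrix NormedSpace

theorem isHermitian_finset_sum {ι : Type*} (s : Finset ι) {n : Type*} {F : ι → Matrix n n ℝ}
    (hF : ∀ i, (F i).IsHermitian) : (∑ i ∈ s, F i).IsHermitian := by
  rw [IsHermitian, conjTranspose_sum]
  exact Finset.sum_congr rfl fun i _ => hF i

theorem isHermitian_vecMulVec_self {n : Type*} (u : n → ℝ) : (vecMulVec u u).IsHermitian := by
  ext i j; simp [vecMulVec_apply, mul_comm]

variable {n : Type*} [Fintype n] {α : Type*} [MeasurableSpace α]

theorem dotProduct_vecMulVec_self_mulVec (u x : n → ℝ) :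
    x ⬝ᵥ vecMulVec u u *ᵥ x = (u ⬝ᵥ x) ^ 2 := by
  rw [vecMulVec_mulVec, dotProduct_smul, dotProduct_comm x u]
  simp [sq]

/-- The data of a random vector `u` in the unit ball with second-moment matrix `M`. -/
structure IsSecondMoment (μ : Measure α) (u : α → n → ℝ) (M : Matrix n n ℝ) : Prop where
  measurable : ∀ i, Measurable fun x => u x i
  dotProduct_self_le : ∀ x, u x ⬝ᵥ u x ≤ 1
  apply_eq : ∀ i j, M i j = ∫ x, u x i * u x j ∂μ

namespace IsSecondMoment

variable {μ : Measure α} {u : α → n → ℝ} {M : Matrix n n ℝ}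

theorem isHermitian (h : IsSecondMoment μ u M) : M.IsHermitian := by
  ext i j
  simp [h.apply_eq, mul_comm]

variable [IsProbabilityMeasure μ]

theorem integrable_mul (h : IsSecondMoment μ u M) (i j : n) :
    Integrable (fun x => u x i * u x j) μ := by
  have hb : ∀ x i, |u x i| ≤ 1 := fun x i => by
    have h1 := Finset.single_le_sum (f := fun i => u x i * u x i)
      (fun i _ => mul_self_nonneg _) (Finset.mem_univ i)
    have h2 := h1.trans (h.dotProduct_self_le x)
    exact abs_le_one_iff_mul_self_le_one.mpr h2
  refine Integrable.of_bound ((h.measurable i).mul (h.measurable j)).aestronglyMeasurable 1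
    (Filter.Eventually.of_forall fun x => ?_)
  rw [Real.norm_eq_abs, abs_mul]
  exact mul_le_one₀ (hb x i) (abs_nonneg _) (hb x j)

theorem trace_mul_eq_sum (B : Matrix n n ℝ) (v : n → ℝ) :
    (B * vecMulVec v v).trace = ∑ i, ∑ j, B i j * (v j * v i) := by
  simp [Matrix.trace, Matrix.mul_apply, vecMulVec_apply]

theorem integrable_trace_mul (h : IsSecondMoment μ u M) (B : Matrix n n ℝ) :
    Integrable (fun x => (B * vecMulVec (u x) (u x)).trace) μ := by
  simp only [trace_mul_eq_sum]
  exact integrable_finsetSum _ fun i _ => integrable_finsetSum _ fun j _ =>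
    (h.integrable_mul j i).const_mul _

theorem integral_trace_mul (h : IsSecondMoment μ u M) (B : Matrix n n ℝ) :
    ∫ x, (B * vecMulVec (u x) (u x)).trace ∂μ = (B * M).trace := by
  simp only [trace_mul_eq_sum]
  rw [integral_finsetSum Finset.univ (f := fun i x => ∑ j, B i j * (u x j * u x i))
    fun i _ => integrable_finsetSum _ fun j _ => (h.integrable_mul j i).const_mul _]
  simp only [Matrix.trace, Matrix.diag, Matrix.mul_apply]
  refine Finset.sum_congr rfl fun i _ => ?_
  rw [integral_finsetSum Finset.univ (f := fun j x => B i j * (u x j * u x i))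
    fun j _ => (h.integrable_mul j i).const_mul _]
  refine Finset.sum_congr rfl fun j _ => ?_
  rw [integral_const_mul, h.apply_eq]

theorem dotProduct_mulVec_eq (h : IsSecondMoment μ u M) (x : n → ℝ) :
    x ⬝ᵥ M *ᵥ x = ∫ a, (u a ⬝ᵥ x) ^ 2 ∂μ := by
  have e : ∀ B : Matrix n n ℝ, (vecMulVec x x * B).trace = x ⬝ᵥ B *ᵥ x := fun B => by
    rw [trace_mul_comm, mul_vecMulVec, trace_vecMulVec, dotProduct_comm]
  rw [← e, ← h.integral_trace_mul]
  simp only [e, dotProduct_vecMulVec_self_mulVec]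

theorem dotProduct_mulVec_le (h : IsSecondMoment μ u M) (x : n → ℝ) : x ⬝ᵥ M *ᵥ x ≤ x ⬝ᵥ x := by
  rw [h.dotProduct_mulVec_eq]
  have hx : 0 ≤ x ⬝ᵥ x := by simpa using dotProduct_star_self_nonneg x
  refine (integral_mono_of_nonneg (Filter.Eventually.of_forall fun a => sq_nonneg _)
    (integrable_const (x ⬝ᵥ x)) (Filter.Eventually.of_forall fun a => ?_)).trans_eq (by simp)
  have h1 : (u a ⬝ᵥ x) ^ 2 ≤ (u a ⬝ᵥ u a) * (x ⬝ᵥ x) := by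
    simpa [dotProduct, sq] using Finset.sum_mul_sq_le_sq_mul_sq Finset.univ (u a) x
  exact h1.trans (mul_le_of_le_one_left hx (h.dotProduct_self_le a))

theorem posSemidef (h : IsSecondMoment μ u M) : M.PosSemidef :=
  .of_dotProduct_mulVec_nonneg h.isHermitian fun x => by
    rw [star_trivial, h.dotProduct_mulVec_eq]
    exact integral_nonneg fun a => sq_nonneg _

/-- Both quadratic forms lie in `[0, ‖x‖²]`, hence so does the modulus of their difference; a
triangle inequality would lose a factor 2. -/
theorem abs_dotProduct_sub_mulVec_le (h : IsSecondMoment μ u M) (a : α) (x : n → ℝ) :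
    |x ⬝ᵥ (vecMulVec (u a) (u a) - M) *ᵥ x| ≤ x ⬝ᵥ x := by
  have hx : 0 ≤ x ⬝ᵥ x := by simpa using dotProduct_star_self_nonneg x
  have h1 : (u a ⬝ᵥ x) ^ 2 ≤ (u a ⬝ᵥ u a) * (x ⬝ᵥ x) := by
    simpa [dotProduct, sq] using Finset.sum_mul_sq_le_sq_mul_sq Finset.univ (u a) x
  have h2 := h.posSemidef.dotProduct_mulVec_nonneg x
  rw [star_trivial] at h2
  rw [sub_mulVec, dotProduct_sub, dotProduct_vecMulVec_self_mulVec, abs_le]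
  have h3 := h.dotProduct_mulVec_le x
  have h4 := h.dotProduct_self_le a
  constructor <;> nlinarith [sq_nonneg (u a ⬝ᵥ x)]

end IsSecondMoment

variable [DecidableEq n]

theorem measurable_trace_exp_mul (A : Matrix n n ℝ) {F : α → Matrix n n ℝ}
    (hF : ∀ i j, Measurable fun x => F x i j) : Measurable fun x => (A * exp (F x)).trace := by
  have h1 : Continuous fun B : n → n → ℝ => (A * exp (Matrix.of B)).trace :=
    (continuous_const.matrix_mul (continuous_matrix_exp.comp continuous_id)).matrix_trace
  exact h1.measurable.comp (measurable_pi_lambda _ fun i => measurable_pi_lambda _ fun j => hF i j)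

theorem measurable_trace_exp {F : α → Matrix n n ℝ}
    (hF : ∀ i j, Measurable fun x => F x i j) : Measurable fun x => (exp (F x)).trace := by
  simpa using measurable_trace_exp_mul 1 hF

/-- The Ahlswede–Winter bound on the trace exponential of a sum of independent symmetric random
matrices. -/
theorem lintegral_trace_exp_add_sum_le (μ : Measure α) [IsProbabilityMeasure μ]
    {Y : α → Matrix n n ℝ} (hYm : ∀ i j, Measurable fun x => Y x i j)
    (hYs : ∀ x, (Y x).IsHermitian) (c : ENNReal)
    (hc : ∀ A : Matrix n n ℝ, A.PosSemidef →
      ∫⁻ x, ENNReal.ofReal (A * exp (Y x)).trace ∂μ ≤ c * ENNReal.ofReal A.trace)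
    (m : ℕ) {A : Matrix n n ℝ} (hA : A.IsHermitian) :
    ∫⁻ x, ENNReal.ofReal (exp (A + ∑ l, Y (x l))).trace ∂(Measure.pi fun _ : Fin m => μ)
      ≤ c ^ m * ENNReal.ofReal (exp A).trace := by
  induction m generalizing A with
  | zero => simp
  | succ m ih =>
    have hmp := (measurePreserving_piFinSuccAbove (fun _ : Fin (m + 1) => μ) 0).symm
    have hm : Measurable fun x : Fin (m + 1) → α =>
        ENNReal.ofReal (exp (A + ∑ l, Y (x l))).trace := by
      refine (measurable_trace_exp fun i j => ?_).ennreal_ofReal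
      simp only [Matrix.add_apply, Matrix.sum_apply]
      exact measurable_const.add (Finset.measurable_fun_sum _ fun l _ =>
        (hYm i j).comp (measurable_pi_apply l))
    rw [← hmp.lintegral_comp hm]
    refine (lintegral_prod (μ := μ) (ν := Measure.pi fun _ : Fin m => μ) _
      (hm.comp hmp.measurable).aemeasurable).trans_le ?_
    have e : ∀ (a : α) (x : Fin m → α), A + ∑ l : Fin (m + 1),
        Y ((MeasurableEquiv.piFinSuccAbove (fun _ : Fin (m + 1) => α) 0).symm (a, x) l)
          = A + Y a + ∑ l, Y (x l) := by
      intro a x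
      rw [Fin.sum_univ_succ, ← add_assoc]
      rfl
    simp only [Function.comp_apply, e]
    -- With the first sample `a` frozen, the induction hypothesis applies to the deterministic
    -- matrix `A + Y a`, which is why `A` is arbitrary; Golden–Thompson then isolates `exp (Y a)`.
    calc _ ≤ ∫⁻ a, c ^ m * ENNReal.ofReal (exp A * exp (Y a)).trace ∂μ :=
          lintegral_mono fun a => (ih (hA.add (hYs a))).trans (by
            gcongr; exact trace_exp_add_le hA (hYs a))
      _ = c ^ m * ∫⁻ a, ENNReal.ofReal (exp A * exp (Y a)).trace ∂μ :=
          lintegral_const_mul _ (measurable_trace_exp_mul _ hYm).ennreal_ofReal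
      _ ≤ c ^ m * (c * ENNReal.ofReal (exp A).trace) := by
          gcongr; exact hc _ (posSemidef_exp hA)
      _ = _ := by rw [pow_succ, mul_assoc]

namespace IsSecondMoment

variable {μ : Measure α} [IsProbabilityMeasure μ] {u : α → n → ℝ} {M : Matrix n n ℝ}

/-- Put `W = u uᵀ`. Bound `exp(s(W - M))` by `1 + s(W - M) + s²(W - M)²`. The linear term has mean
zero, and `W² ≤ W` gives `E(W - M)² ≤ M - M² ≤ l`; finally `1 + s²l ≤ exp(s²l)`. -/
theorem lintegral_trace_mul_exp_le (h : IsSecondMoment μ u M) {l s : ℝ}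
    (hM : ∀ x, x ⬝ᵥ M *ᵥ x ≤ l * (x ⬝ᵥ x)) (hs : |s| ≤ 1) {A : Matrix n n ℝ}
    (hA : A.PosSemidef) :
    ∫⁻ x, ENNReal.ofReal (A * exp (s • (vecMulVec (u x) (u x) - M))).trace ∂μ
      ≤ ENNReal.ofReal (Real.exp (s ^ 2 * l)) * ENNReal.ofReal A.trace := by
  have hherm : ∀ x, (s • (vecMulVec (u x) (u x) - M)).IsHermitian := fun x => by
    rw [IsHermitian, conjTranspose_smul, ((isHermitian_vecMulVec_self _).sub h.isHermitian).eq,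
      star_trivial]
  -- After `W²` is replaced by `W`, the bound is affine in `W`: `B` is its linear coefficient and
  -- `k` its constant, so integrating only replaces `W` by `M`.
  set B : Matrix n n ℝ := s • A + s ^ 2 • (A - M * A - A * M) with hB
  set k : ℝ := A.trace - s * (A * M).trace + s ^ 2 * (A * (M * M)).trace with hk
  have hpt : ∀ x, (A * exp (s • (vecMulVec (u x) (u x) - M))).trace
      ≤ k + (B * vecMulVec (u x) (u x)).trace := by
    intro x
    set W := vecMulVec (u x) (u x) with hW
    have h1 := trace_mul_nonneg hA (posSemidef_quadratic_sub_exp (hherm x) fun y => by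
      rw [smul_mulVec, dotProduct_smul, smul_eq_mul, abs_mul]
      exact (mul_le_of_le_one_left (abs_nonneg _) hs).trans
        (h.abs_dotProduct_sub_mulVec_le x y))
    have hWW : W * W = (u x ⬝ᵥ u x) • W := by
      rw [hW, vecMulVec_mul_vecMulVec]
      ext i j; simp [vecMulVec_apply, mul_left_comm]
    have hAW : 0 ≤ (A * W).trace := by
      refine trace_mul_nonneg hA ?_
      simpa using posSemidef_vecMulVec_self_star (u x)
    have h2 : A * (s • (W - M)) ^ 2
        = s ^ 2 • (A * (W * W) - A * W * M - A * M * W + A * (M * M)) := by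
      rw [smul_pow]
      simp only [sq, mul_smul_comm]
      congr 1
      noncomm_ring
    rw [mul_sub, mul_add, mul_add, mul_one, h2, trace_sub, trace_add, trace_add] at h1
    simp only [mul_smul_comm, trace_smul, mul_sub, trace_sub, trace_add, hWW, smul_eq_mul,
      trace_mul_comm (A * W) M] at h1
    rw [← mul_assoc M A W] at h1
    simp only [hB, hk, add_mul, sub_mul, smul_mul_assoc, trace_add, trace_sub, trace_smul,
      smul_eq_mul]
    nlinarith [mul_le_mul_of_nonneg_left
      (mul_le_mul_of_nonneg_right (h.dotProduct_self_le x) hAW) (sq_nonneg s)]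
  have hnn : ∀ x, 0 ≤ (A * exp (s • (vecMulVec (u x) (u x) - M))).trace := fun x =>
    trace_mul_nonneg hA (posSemidef_exp (hherm x))
  have hint := h.integrable_trace_mul B
  calc _ ≤ ∫⁻ x, ENNReal.ofReal (k + (B * vecMulVec (u x) (u x)).trace) ∂μ :=
        lintegral_mono fun x => ENNReal.ofReal_le_ofReal (hpt x)
    _ = ENNReal.ofReal (k + (B * M).trace) := by
        rw [← ofReal_integral_eq_lintegral_ofReal
          (f := fun x => k + (B * vecMulVec (u x) (u x)).trace) ((integrable_const k).add hint)
          (Filter.Eventually.of_forall fun x => (hnn x).trans (hpt x)),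
          integral_add (integrable_const k) hint, h.integral_trace_mul]
        simp
    _ ≤ ENNReal.ofReal (Real.exp (s ^ 2 * l) * A.trace) := by
        refine ENNReal.ofReal_le_ofReal ?_
        have hMM : 0 ≤ (A * (M * M)).trace := by
          have := posSemidef_self_mul_conjTranspose M
          rw [h.isHermitian.eq] at this
          exact trace_mul_nonneg hA this
        have hlM : 0 ≤ l * A.trace - (A * M).trace := by
          have hP : (l • (1 : Matrix n n ℝ) - M).PosSemidef := by
            refine .of_dotProduct_mulVec_nonneg ?_ fun x => ?_
            · exact IsHermitian.sub (by simp [IsHermitian]) h.isHermitian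
            · have := hM x
              simp only [sub_mulVec, smul_mulVec, one_mulVec, dotProduct_sub, dotProduct_smul,
                star_trivial, smul_eq_mul]
              linarith
          simpa [mul_sub] using trace_mul_nonneg hA hP
        have hexp := mul_le_mul_of_nonneg_right (Real.add_one_le_exp (s ^ 2 * l))
          hA.trace_nonneg
        have e : (B * M).trace = s * (A * M).trace
            + s ^ 2 * ((A * M).trace - (A * (M * M)).trace - (A * (M * M)).trace) := by
          simp only [hB, add_mul, sub_mul, smul_mul_assoc, trace_add, trace_sub, trace_smul,
            smul_eq_mul]
          rw [mul_assoc M A M, trace_mul_comm M, mul_assoc A M M]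
        rw [e, hk]
        nlinarith [mul_nonneg (sq_nonneg s) hMM, mul_nonneg (sq_nonneg s) hlM]
    _ = _ := ENNReal.ofReal_mul (Real.exp_pos _).le

/-- One-sided matrix Bernstein inequality for sums of independent rank-one matrices. -/
theorem measure_exists_le_sum_le (h : IsSecondMoment μ u M) {l s : ℝ}
    (hM : ∀ x, x ⬝ᵥ M *ᵥ x ≤ l * (x ⬝ᵥ x)) (hs : |s| ≤ 1) (m : ℕ) (a : ℝ) :
    (Measure.pi fun _ : Fin m => μ) {x | ∃ y : n → ℝ, y ⬝ᵥ y = 1 ∧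
        a ≤ y ⬝ᵥ (∑ i, s • (vecMulVec (u (x i)) (u (x i)) - M)) *ᵥ y}
      ≤ ENNReal.ofReal (Fintype.card n * Real.exp (m * (s ^ 2 * l) - a)) := by
  set Y : α → Matrix n n ℝ := fun x => s • (vecMulVec (u x) (u x) - M) with hY
  have hYs : ∀ x, (Y x).IsHermitian := fun x => by
    rw [hY, IsHermitian, conjTranspose_smul,
      ((isHermitian_vecMulVec_self _).sub h.isHermitian).eq, star_trivial]
  have hYm : ∀ i j, Measurable fun x => Y x i j := fun i j => by
    simp only [hY, Matrix.smul_apply, Matrix.sub_apply, vecMulVec_apply, smul_eq_mul]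
    exact (((h.measurable i).mul (h.measurable j)).sub_const _).const_mul _
  have hSm : Measurable fun x : Fin m → α => (exp (∑ i, Y (x i))).trace :=
    measurable_trace_exp fun i j => by
      simp only [Matrix.sum_apply]
      exact Finset.measurable_fun_sum _ fun l _ => (hYm i j).comp (measurable_pi_apply l)
  -- Starting from `A = 0`, the initial value `tr 1` is the dimensional factor of the bound.
  have hAW := lintegral_trace_exp_add_sum_le μ hYm hYs _
    (fun A hA => h.lintegral_trace_mul_exp_le hM hs hA) m
    (A := 0) (by simp [IsHermitian])
  simp only [zero_add, exp_zero, trace_one] at hAW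
  calc _ ≤ (Measure.pi fun _ : Fin m => μ)
        {x | ENNReal.ofReal (Real.exp a) ≤ ENNReal.ofReal (exp (∑ i, Y (x i))).trace} := by
        refine measure_mono ?_
        rintro x ⟨y, hy, hya⟩
        exact ENNReal.ofReal_le_ofReal
          (exp_le_trace_exp (isHermitian_finset_sum _ fun i => hYs _) hy hya)
    _ ≤ _ := meas_ge_le_lintegral_div hSm.ennreal_ofReal.aemeasurable
        (by simpa using Real.exp_pos a) ENNReal.ofReal_ne_top
    _ ≤ ENNReal.ofReal (Real.exp (s ^ 2 * l)) ^ m * ENNReal.ofReal (Fintype.card n)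
          / ENNReal.ofReal (Real.exp a) := by gcongr
    _ = _ := by
        rw [← ENNReal.ofReal_pow (Real.exp_pos _).le, ← ENNReal.ofReal_mul (by positivity),
          ← ENNReal.ofReal_div_of_pos (Real.exp_pos a), ← Real.exp_nat_mul, Real.exp_sub]
        congr 1
        ring

end IsSecondMoment

end MatrixConcentration

/-! ### Davis–Kahan perturbation of the top eigenvector. -/

section EigenvectorPerturbation

open scoped InnerProductSpace

/-- Polarization: subtract the quadratic forms at `x ± ‖x‖ y` and use the parallelogram law.
Rescaling `y` to the length of `x` is what makes the constant exactly `t`. -/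
theorem abs_inner_le_of_abs_inner_self_le {E : Type*} [NormedAddCommGroup E] [InnerProductSpace ℝ E]
    {R : E →L[ℝ] E} (hR : ∀ x y, ⟪R x, y⟫_ℝ = ⟪x, R y⟫_ℝ) {t : ℝ}
    (h : ∀ x, |⟪x, R x⟫_ℝ| ≤ t * ‖x‖ ^ 2) (x : E) {y : E} (hy : ‖y‖ = 1) :
    ⟪x, R y⟫_ℝ ≤ t * ‖x‖ := by
  rcases eq_or_ne x 0 with rfl | hx
  · simp
  have hx' : 0 < ‖x‖ := norm_pos_iff.mpr hx
  have h1 := (abs_le.mp (h (x + ‖x‖ • y))).2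
  have h2 := (abs_le.mp (h (x - ‖x‖ • y))).1
  have h3 := parallelogram_law_with_norm ℝ x (‖x‖ • y)
  have h4 : ⟪y, R x⟫_ℝ = ⟪x, R y⟫_ℝ := by rw [real_inner_comm, hR]
  simp only [map_add, map_sub, map_smul, inner_add_left, inner_add_right, inner_sub_left,
    inner_sub_right, inner_smul_left, inner_smul_right, h4] at h1 h2
  simp only [norm_smul, norm_norm, hy, mul_one] at h3
  simp only [RCLike.conj_to_real] at h1 h2
  have h5 : ‖x‖ * ⟪x, R y⟫_ℝ ≤ ‖x‖ * (t * ‖x‖) := by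
    have h6 := congrArg (t * ·) h3
    simp only [mul_add] at h6
    linarith
  exact le_of_mul_le_mul_left h5 hx'

/-- A Davis–Kahan bound for the top eigenvector. -/
theorem norm_sub_le_or_norm_add_le_of_eigengap {E : Type*} [NormedAddCommGroup E]
    [InnerProductSpace ℝ E] {T S : E →L[ℝ] E} (hsym : ∀ x y, ⟪(S - T) x, y⟫_ℝ = ⟪x, (S - T) y⟫_ℝ)
    {v w : E} (hv : ‖v‖ = 1) (hw : ‖w‖ = 1) {a g ρ : ℝ} (hTv : T v = a • v)
    (hSw : S w = ‖S‖ • w) (hg : 0 < g) (hρ : 0 < ρ) (hρ1 : ρ ≤ 1)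
    (hgap : ∀ x, ⟪v, x⟫_ℝ = 0 → ⟪x, T x⟫_ℝ ≤ (a - g) * ‖x‖ ^ 2)
    (hST : ∀ x, |⟪x, (S - T) x⟫_ℝ| ≤ ρ * g / 3 * ‖x‖ ^ 2) :
    ‖v - w‖ ≤ ρ ∨ ‖v + w‖ ≤ ρ := by
  have hS : a - ρ * g / 3 ≤ ‖S‖ := by
    have h1 := (abs_le.mp (hST v)).1
    have h2 : ⟪v, S v⟫_ℝ ≤ ‖S‖ := by
      refine (real_inner_le_norm _ _).trans ?_
      simpa [hv] using S.le_opNorm v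
    rw [sub_apply, inner_sub_right, hTv, inner_smul_right,
      real_inner_self_eq_norm_sq, hv] at h1
    linarith
  set c := ⟪v, w⟫_ℝ with hc
  set p := w - c • v with hp
  have hvp : ⟪v, p⟫_ℝ = 0 := by
    rw [hp, inner_sub_right, inner_smul_right, real_inner_self_eq_norm_sq, hv]; simp [hc]
  have hpv : ⟪p, v⟫_ℝ = 0 := by rw [real_inner_comm, hvp]
  have hwp : w = p + c • v := by simp [hp]
  have hpw : ⟪p, w⟫_ℝ = ‖p‖ ^ 2 := by
    conv_lhs => rw [hwp]
    rw [inner_add_right, inner_smul_right, hpv, real_inner_self_eq_norm_sq]; simp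
  have hpn : ‖p‖ ^ 2 = 1 - c ^ 2 := by
    rw [← hpw, hp, inner_sub_left, inner_smul_left, real_inner_self_eq_norm_sq, hw, ← hc]
    simp [sq]
  have hpT : ⟪p, T w⟫_ℝ ≤ (a - g) * ‖p‖ ^ 2 := by
    conv_lhs => rw [hwp]
    rw [map_add, map_smul, hTv, inner_add_right, inner_smul_right, inner_smul_right, hpv]
    simpa using hgap p hvp
  have hkey := abs_inner_le_of_abs_inner_self_le hsym hST p hw
  rw [sub_apply, inner_sub_right, hSw, inner_smul_right, hpw] at hkey
  have h0 : 0 ≤ ‖p‖ := norm_nonneg _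
  -- Here `p` is the part of `w` orthogonal to `v`, and `⟪p, (S - T) w⟫` is bounded below by the gap
  -- and above by the perturbation. Since `ρ ≤ 1`, the resulting `(ρ/3)/(1 - ρ/3)` is at most `ρ/2`.
  have h1 : g * ((1 - ρ / 3) * ‖p‖ ^ 2) ≤ g * (ρ / 3 * ‖p‖) := by
    nlinarith [mul_le_mul_of_nonneg_right hS (sq_nonneg ‖p‖)]
  have h2 : (1 - ρ / 3) * ‖p‖ ^ 2 ≤ ρ / 3 * ‖p‖ := le_of_mul_le_mul_left h1 hg
  have h3 : ‖p‖ ≤ ρ / 2 := by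
    by_contra! hlt
    nlinarith [mul_pos hρ (hρ.trans (by linarith : ρ < 2 * ‖p‖))]
  have hc1 : c ^ 2 ≤ 1 := by nlinarith
  have hbound : (2 - 2 * |c|) ≤ ρ ^ 2 := by
    have h4 : |c| ≤ 1 := (sq_le_one_iff_abs_le_one c).mp hc1
    have h5 : 1 - |c| ≤ 1 - c ^ 2 := by
      rw [← sq_abs c]; nlinarith [abs_nonneg c]
    nlinarith
  rcases le_total 0 c with h | h
  · left
    refine abs_le_of_sq_le_sq' ?_ hρ.le |>.2
    rw [norm_sub_sq_real, hv, hw, ← hc]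
    rw [abs_of_nonneg h] at hbound
    linarith
  · right
    refine abs_le_of_sq_le_sq' ?_ hρ.le |>.2
    rw [norm_add_sq_real, hv, hw, ← hc]
    rw [abs_of_nonpos h] at hbound
    linarith

variable {d : ℕ} {A : Matrix (Fin d) (Fin d) ℝ}

open Matrix in
theorem toEuclideanCLM_inner_comm (hA : A.IsHermitian) (x y : EuclideanSpace ℝ (Fin d)) :
    ⟪toEuclideanCLM (n := Fin d) (𝕜 := ℝ) A x, y⟫_ℝ
      = ⟪x, toEuclideanCLM (n := Fin d) (𝕜 := ℝ) A y⟫_ℝ := by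
  rw [real_inner_comm, inner_toEuclideanCLM, inner_toEuclideanCLM, dotProduct_mulVec,
    ← mulVec_transpose, dotProduct_comm, ← conjTranspose_eq_transpose_of_trivial, hA.eq]

open Matrix in
-- The positive gap makes `v` orthogonal to every basis eigenvector except the one of index 0, so
-- `v` is a multiple of that one and `x ⊥ v` has no component along it.
theorem inner_toEuclideanCLM_le_of_eigengap (hA : A.IsHermitian) {g : ℝ} (hg : 0 < g)
    (hgap : HasTopEigengap A hA g) {v : EuclideanSpace ℝ (Fin d)} (hv : IsTopEigenvector A v)
    {x : EuclideanSpace ℝ (Fin d)} (hx : ⟪v, x⟫_ℝ = 0) :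
    ⟪x, toEuclideanCLM (n := Fin d) (𝕜 := ℝ) A x⟫_ℝ ≤ (specNorm A - g) * ‖x‖ ^ 2 := by
  set T := toEuclideanCLM (n := Fin d) (𝕜 := ℝ) A with hT
  set b := hA.eigenvectorBasis
  set φ := Fintype.equivOfCardEq (Fintype.card_fin (Fintype.card (Fin d))) with hφ
  have hTb : ∀ j, T (b j) = hA.eigenvalues j • b j := fun j => by
    apply (WithLp.ofLp_injective 2)
    simpa [hT] using hA.mulVec_eigenvectorBasis j
  have hlow : ∀ j, 1 ≤ ((φ.symm j : Fin _) : ℕ) →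
      hA.eigenvalues j ≤ specNorm A - g ∧ ⟪v, b j⟫_ℝ = 0 := fun j hj => by
    have h1 : hA.eigenvalues j ≤ specNorm A - g := by
      have := hgap _ hj
      have e : hA.eigenvalues j = hA.eigenvalues₀ (φ.symm j) := rfl
      linarith
    refine ⟨h1, ?_⟩
    have h2 := toEuclideanCLM_inner_comm hA v (b j)
    rw [hv.2, ← hT, hTb, inner_smul_left, inner_smul_right] at h2
    simp only [RCLike.conj_to_real] at h2
    have h3 : (specNorm A - hA.eigenvalues j) * ⟪v, b j⟫_ℝ = 0 := by linarith
    exact (mul_eq_zero.mp h3).resolve_left (by linarith)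
  have hterm : ∀ j, hA.eigenvalues j * ⟪x, b j⟫_ℝ ^ 2 ≤ (specNorm A - g) * ⟪x, b j⟫_ℝ ^ 2 := by
    intro j
    by_cases hj : 1 ≤ ((φ.symm j : Fin _) : ℕ)
    · exact mul_le_mul_of_nonneg_right (hlow j hj).1 (sq_nonneg _)
    · have hz : ∀ i, i ≠ j → ⟪v, b i⟫_ℝ = 0 := fun i hij => (hlow i (by
        by_contra hi
        exact hij (φ.symm.injective (Fin.ext (by omega))))).2
      have h1 := b.sum_inner_mul_inner v x
      have h2 := b.sum_inner_mul_inner v v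
      rw [Finset.sum_eq_single j (fun i _ hi => by rw [hz i hi, zero_mul]) (by simp)] at h1 h2
      rw [real_inner_self_eq_norm_sq, hv.1] at h2
      rw [hx] at h1
      have h3 : ⟪v, b j⟫_ℝ ≠ 0 := fun h => by rw [h] at h2; norm_num at h2
      rw [real_inner_comm, (mul_eq_zero.mp h1).resolve_left h3]
      simp
  have e1 : ⟪x, T x⟫_ℝ = ∑ j, hA.eigenvalues j * ⟪x, b j⟫_ℝ ^ 2 := by
    rw [← b.sum_inner_mul_inner]
    refine Finset.sum_congr rfl fun j _ => ?_
    rw [hT, ← toEuclideanCLM_inner_comm hA, ← hT, hTb, inner_smul_left, real_inner_comm (b j) x]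
    simp only [RCLike.conj_to_real]
    ring
  have e2 : ‖x‖ ^ 2 = ∑ j, ⟪x, b j⟫_ℝ ^ 2 := by
    rw [← real_inner_self_eq_norm_sq, ← b.sum_inner_mul_inner]
    exact Finset.sum_congr rfl fun j _ => by rw [real_inner_comm x (b j), sq]
  rw [e1, e2, Finset.mul_sum]
  exact Finset.sum_le_sum fun j _ => hterm j

end EigenvectorPerturbation

/-! ### Application to the attack matrices. -/

section AttackMatrix

open Matrix
open scoped InnerProductSpace

variable {d : ℕ}

theorem dotProduct_self_eq_norm_sq (x : EuclideanSpace ℝ (Fin d)) :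
    x.ofLp ⬝ᵥ x.ofLp = ‖x‖ ^ 2 := by
  rw [← real_inner_self_eq_norm_sq, EuclideanSpace.inner_eq_star_dotProduct, star_trivial]

theorem dotProduct_mulVec_le_specNorm (A : Matrix (Fin d) (Fin d) ℝ) (x : Fin d → ℝ) :
    x ⬝ᵥ A *ᵥ x ≤ specNorm A * (x ⬝ᵥ x) := by
  have h := inner_toEuclideanCLM A (WithLp.toLp 2 x) (WithLp.toLp 2 x)
  have h2 := dotProduct_self_eq_norm_sq (WithLp.toLp 2 x)
  simp only at h h2
  rw [← h, h2]
  refine (real_inner_le_norm _ _).trans ?_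
  rw [sq, ← mul_assoc, mul_comm]
  gcongr
  exact ContinuousLinearMap.le_opNorm _ _

section Norm

variable {𝒜 : EuclideanSpace ℝ (Fin d) → EuclideanSpace ℝ (Fin d)}

theorem norm_attackDir {x : EuclideanSpace ℝ (Fin d)} (hx : 𝒜 x ≠ 0) : ‖attackDir 𝒜 x‖ = 1 := by
  rw [attackDir, norm_smul, norm_inv, norm_norm, inv_mul_cancel₀ (norm_ne_zero_iff.mpr hx)]

/-- Where `𝒜` vanishes the direction is 0, as `0⁻¹ = 0`; the bound thus holds everywhere, as
`IsSecondMoment` demands. -/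
theorem norm_attackDir_le (x : EuclideanSpace ℝ (Fin d)) : ‖attackDir 𝒜 x‖ ≤ 1 := by
  by_cases hx : 𝒜 x = 0
  · simp [attackDir, hx]
  · exact (norm_attackDir hx).le

theorem measurable_attackDir (h𝒜 : Measurable 𝒜) : Measurable (attackDir 𝒜) :=
  h𝒜.norm.inv.smul h𝒜

end Norm

variable {k : ℕ} {D : Measure (EuclideanSpace ℝ (Fin d) × Fin k)}
  {𝒜 : EuclideanSpace ℝ (Fin d) → EuclideanSpace ℝ (Fin d)}

theorem measurable_attackDir_apply (h𝒜 : Measurable 𝒜) (i : Fin d) :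
    Measurable fun x => attackDir 𝒜 x i :=
  (PiLp.continuous_apply 2 (fun _ : Fin d => ℝ) i).measurable.comp (measurable_attackDir h𝒜)

theorem isSecondMoment_attackMatrix (h𝒜 : Measurable 𝒜) :
    IsSecondMoment D.fst (fun x => (attackDir 𝒜 x).ofLp) (attackMatrix D 𝒜) where
  measurable := measurable_attackDir_apply h𝒜
  dotProduct_self_le x := by
    rw [dotProduct_self_eq_norm_sq]
    exact pow_le_one₀ (norm_nonneg _) (norm_attackDir_le x)
  apply_eq i j := by
    exact (integral_map (f := fun x => attackDir 𝒜 x i * attackDir 𝒜 x j)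
      measurable_fst.aemeasurable ((measurable_attackDir_apply h𝒜 i).mul
        (measurable_attackDir_apply h𝒜 j)).aestronglyMeasurable).symm

variable [IsProbabilityMeasure D]

theorem trace_attackMatrix (h𝒜 : Measurable 𝒜) (h0 : ∀ᵐ z ∂D, 𝒜 z.1 ≠ 0) :
    (attackMatrix D 𝒜).trace = 1 := by
  have h := isSecondMoment_attackMatrix (D := D) h𝒜
  have h1 := h.integral_trace_mul 1
  rw [one_mul] at h1
  simp only [one_mul, trace_vecMulVec, dotProduct_self_eq_norm_sq] at h1
  rw [← h1, Measure.fst, integral_map measurable_fst.aemeasurable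
    ((measurable_attackDir h𝒜).norm.pow_const 2).aestronglyMeasurable,
    integral_congr_ae (g := fun _ => 1) (h0.mono fun z hz => by
      simp only [norm_attackDir hz, one_pow])]
  simp

theorem specNorm_attackMatrix_pos (h𝒜 : Measurable 𝒜) (h0 : ∀ᵐ z ∂D, 𝒜 z.1 ≠ 0) :
    0 < specNorm (attackMatrix D 𝒜) := by
  refine norm_pos_iff.mpr fun h => ?_
  have h1 := trace_attackMatrix h𝒜 h0
  rw [(map_eq_zero_iff _ (toEuclideanCLM (n := Fin d) (𝕜 := ℝ)).injective).mp h] at h1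
  simp at h1

theorem intrinsicDim_attackMatrix (h𝒜 : Measurable 𝒜) (h0 : ∀ᵐ z ∂D, 𝒜 z.1 ≠ 0) :
    intrinsicDim (attackMatrix D 𝒜) = (specNorm (attackMatrix D 𝒜))⁻¹ := by
  rw [intrinsicDim, trace_attackMatrix h𝒜 h0, one_div]

/-- The second eigenvalue is nonnegative, so the gap cannot exceed `λ`. This yields `ε < 1`, needed
for `|s| ≤ 1` in the Bernstein bound. -/
theorem gap_le_one (h𝒜 : Measurable 𝒜) (h0 : ∀ᵐ z ∂D, 𝒜 z.1 ≠ 0) (hd : 2 ≤ d) {γ : ℝ}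
    (hgap : HasTopEigengap (attackMatrix D 𝒜) (attackMatrix_isHermitian D 𝒜)
      (γ * specNorm (attackMatrix D 𝒜))) : γ ≤ 1 := by
  have hpos := specNorm_attackMatrix_pos h𝒜 h0
  have h1 := hgap ⟨1, by rw [Fintype.card_fin]; omega⟩ le_rfl
  have h2 := (isSecondMoment_attackMatrix (D := D) h𝒜).posSemidef.eigenvalues_nonneg
    (Fintype.equivOfCardEq (Fintype.card_fin (Fintype.card (Fin d))) ⟨1, by rw [Fintype.card_fin]; omega⟩)
  simp only [IsHermitian.eigenvalues, Equiv.symm_apply_apply] at h2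
  nlinarith

theorem sum_smul_sub_attackMatrix {m : ℕ} (x : Fin m → EuclideanSpace ℝ (Fin d)) (s : ℝ)
    (M : Matrix (Fin d) (Fin d) ℝ) :
    ∑ i, s • (vecMulVec (attackDir 𝒜 (x i)).ofLp (attackDir 𝒜 (x i)).ofLp - M)
      = (s * m) • (empiricalAttackMatrix 𝒜 x - M) := by
  rw [← Finset.smul_sum, Finset.sum_sub_distrib, empiricalAttackMatrix, mul_smul]
  congr 1
  rcases Nat.eq_zero_or_pos m with rfl | hm
  · simp
  · rw [smul_sub, smul_smul, mul_one_div_cancel (by positivity), one_smul, Finset.sum_const, Finset.card_univ,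
      Fintype.card_fin, Nat.cast_smul_eq_nsmul]

theorem isHermitian_empiricalAttackMatrix {m : ℕ} (x : Fin m → EuclideanSpace ℝ (Fin d)) :
    (empiricalAttackMatrix 𝒜 x).IsHermitian := by
  rw [empiricalAttackMatrix, IsHermitian, conjTranspose_smul,
    (isHermitian_finset_sum _ fun i => isHermitian_vecMulVec_self _).eq, star_trivial]

theorem toEuclideanCLM_inner_self_le_of_unit {R : Matrix (Fin d) (Fin d) ℝ} {t : ℝ}
    (h : ∀ y : Fin d → ℝ, y ⬝ᵥ y = 1 → |y ⬝ᵥ R *ᵥ y| ≤ t) (x : EuclideanSpace ℝ (Fin d)) :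
    |⟪x, toEuclideanCLM (n := Fin d) (𝕜 := ℝ) R x⟫_ℝ| ≤ t * ‖x‖ ^ 2 := by
  rcases eq_or_ne x 0 with rfl | hx
  · simp
  have hx' : 0 < ‖x‖ := norm_pos_iff.mpr hx
  have h1 := h (‖x‖⁻¹ • x).ofLp (by
    rw [dotProduct_self_eq_norm_sq, norm_smul, norm_inv, norm_norm, inv_mul_cancel₀ hx'.ne',
      one_pow])
  rw [WithLp.ofLp_smul, mulVec_smul, dotProduct_smul, smul_dotProduct, ← inner_toEuclideanCLM,
    smul_eq_mul, smul_eq_mul, ← mul_assoc, abs_mul, abs_of_pos (by positivity)] at h1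
  calc _ = ‖x‖⁻¹ * ‖x‖⁻¹ * |⟪x, toEuclideanCLM (n := Fin d) (𝕜 := ℝ) R x⟫_ℝ| * ‖x‖ ^ 2 := by
        field_simp
    _ ≤ _ := by gcongr

/-- Closeness of the empirical matrix to `M` in spectral norm makes the top eigenvectors close. -/
theorem norm_sub_le_or_norm_add_le_of_attackMatrix (h𝒜 : Measurable 𝒜) (h0 : ∀ᵐ z ∂D, 𝒜 z.1 ≠ 0)
    {γ : ℝ} (hgap : HasTopEigengap (attackMatrix D 𝒜) (attackMatrix_isHermitian D 𝒜)
      (γ * specNorm (attackMatrix D 𝒜)))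
    {v : EuclideanSpace ℝ (Fin d)} (hv : IsTopEigenvector (attackMatrix D 𝒜) v)
    {ε : ℝ} (hε : 0 < ε) (hεγ : ε < γ) {m : ℕ} {x : Fin m → EuclideanSpace ℝ (Fin d)}
    (hx : ∀ y : Fin d → ℝ, y ⬝ᵥ y = 1 →
      |y ⬝ᵥ (empiricalAttackMatrix 𝒜 x - attackMatrix D 𝒜) *ᵥ y|
        ≤ ε * specNorm (attackMatrix D 𝒜) / 3)
    {w : EuclideanSpace ℝ (Fin d)} (hw : IsTopEigenvector (empiricalAttackMatrix 𝒜 x) w) :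
    ‖v - w‖ ≤ ε / γ ∨ ‖v + w‖ ≤ ε / γ := by
  have hγ : 0 < γ := hε.trans hεγ
  have hpos := specNorm_attackMatrix_pos h𝒜 h0
  have hg : 0 < γ * specNorm (attackMatrix D 𝒜) := mul_pos hγ hpos
  refine norm_sub_le_or_norm_add_le_of_eigengap ?_ hv.1 hw.1 hv.2 hw.2 hg (div_pos hε hγ)
    ((div_le_one hγ).mpr hεγ.le)
    (fun y hy => inner_toEuclideanCLM_le_of_eigengap _ hg hgap hv hy) fun y => ?_
  · rw [← map_sub]
    exact toEuclideanCLM_inner_comm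
      ((isHermitian_empiricalAttackMatrix x).sub (attackMatrix_isHermitian D 𝒜))
  · rw [← map_sub]
    convert toEuclideanCLM_inner_self_le_of_unit hx y using 2
    field_simp

theorem measure_eigenvector_far_le (h𝒜 : Measurable 𝒜) (h0 : ∀ᵐ z ∂D, 𝒜 z.1 ≠ 0)
    {γ : ℝ} (hγ1 : γ ≤ 1)
    (hgap : HasTopEigengap (attackMatrix D 𝒜) (attackMatrix_isHermitian D 𝒜)
      (γ * specNorm (attackMatrix D 𝒜)))
    {v : EuclideanSpace ℝ (Fin d)} (hv : IsTopEigenvector (attackMatrix D 𝒜) v)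
    {ε : ℝ} (hε : 0 < ε) (hεγ : ε < γ) {m : ℕ} {Ω : Type*} [MeasurableSpace Ω] {P : Measure Ω}
    [IsProbabilityMeasure P] {X : Fin m → Ω → EuclideanSpace ℝ (Fin d)}
    (hX : ∀ l, HasLaw (X l) D.fst P) (hind : iIndepFun X P) :
    P {ω | ¬ ∀ w, IsTopEigenvector (empiricalAttackMatrix 𝒜 (fun l => X l ω)) w →
        ‖v - w‖ ≤ ε / γ ∨ ‖v + w‖ ≤ ε / γ}
      ≤ ENNReal.ofReal
        (2 * (d * Real.exp (-(m * (specNorm (attackMatrix D 𝒜) * ε ^ 2) / 36)))) := by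
  set M := attackMatrix D 𝒜 with hM
  set l := specNorm M with hl
  have hpos : 0 < l := specNorm_attackMatrix_pos h𝒜 h0
  have hsm := isSecondMoment_attackMatrix (D := D) h𝒜
  have hMl := dotProduct_mulVec_le_specNorm M
  have hlaw : P.map (fun ω i => X i ω) = Measure.pi fun _ => D.fst := by
    rw [hind.map_fun_eq_pi_map fun i => (hX i).aemeasurable]
    congr 1
    funext i
    exact (hX i).map_eq
  -- For `s = ±ε/6` and `m > 0`, the threshold `mε²l/18` corresponds to a deviation `εl/3` of `M̃ -
  -- M`, one sign of `s` for each tail. The Bernstein exponent becomes `mε²l(1/36 - 1/18) =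
  -- -mε²l/36`.
  set B : ℝ → Set (Fin m → EuclideanSpace ℝ (Fin d)) := fun s => {x | ∃ y : Fin d → ℝ, y ⬝ᵥ y = 1 ∧
    m * (ε ^ 2 * l) / 18 ≤ y ⬝ᵥ (∑ i, s •
      (vecMulVec (attackDir 𝒜 (x i)).ofLp (attackDir 𝒜 (x i)).ofLp - M)) *ᵥ y} with hB
  have hBs : ∀ s, s ^ 2 = (ε / 6) ^ 2 → (Measure.pi fun _ : Fin m => D.fst) (B s)
      ≤ ENNReal.ofReal (d * Real.exp (-(m * (l * ε ^ 2) / 36))) := fun s hs => by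
    have hs1 : |s| ≤ 1 := by
      rw [← sq_le_one_iff_abs_le_one, hs]
      exact pow_le_one₀ (by positivity) (by linarith)
    refine (hsm.measure_exists_le_sum_le hMl hs1 m _).trans_eq ?_
    rw [Fintype.card_fin, hs]
    congr 3
    ring
  calc _ ≤ P ((fun ω i => X i ω) ⁻¹' (B (ε / 6) ∪ B (-(ε / 6)))) := by
        refine measure_mono fun ω hω => ?_
        by_contra hnot
        refine hω fun w hw => norm_sub_le_or_norm_add_le_of_attackMatrix h𝒜 h0 hgap hv hε hεγ
          (fun y hy => ?_) hw
        simp only [Set.mem_preimage, Set.mem_union, not_or, hB, Set.mem_ofPred_eq,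
          not_exists, not_and, not_le] at hnot
        have h1 := hnot.1 y hy
        have h2 := hnot.2 y hy
        simp only [sum_smul_sub_attackMatrix, smul_mulVec, dotProduct_smul, smul_eq_mul] at h1 h2
        have hq : 0 ≤ ε / 6 * m := by positivity
        rw [abs_le]
        constructor
        · by_contra! hlt
          nlinarith [mul_le_mul_of_nonneg_left hlt.le hq]
        · by_contra! hlt
          nlinarith [mul_le_mul_of_nonneg_left hlt.le hq]
    -- This inequality holds for arbitrary sets, so `B` need not be shown measurable.
    _ ≤ P.map (fun ω i => X i ω) (B (ε / 6) ∪ B (-(ε / 6))) :=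
        Measure.le_map_apply (aemeasurable_pi_lambda _ fun i => (hX i).aemeasurable) _
    _ ≤ _ := by
        rw [hlaw]
        refine (measure_union_le _ _).trans ((add_le_add (hBs _ rfl) (hBs _ (by ring))).trans_eq ?_)
        rw [← ENNReal.ofReal_add (by positivity) (by positivity), two_mul]

theorem eq_or_eq_neg_of_norm_eq_one {v w : EuclideanSpace ℝ (Fin 1)} (hv : ‖v‖ = 1)
    (hw : ‖w‖ = 1) : v = w ∨ v = -w := by
  have hv' : |v 0| = 1 := by simpa [EuclideanSpace.norm_eq, Real.sqrt_sq_eq_abs] using hv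
  have hw' : |w 0| = 1 := by simpa [EuclideanSpace.norm_eq, Real.sqrt_sq_eq_abs] using hw
  refine (abs_eq_abs.mp (hv'.trans hw'.symm)).imp (fun h => ?_) fun h => ?_ <;>
  · ext i
    rw [Subsingleton.elim i 0]
    simpa using h

end AttackMatrix

/-- The factor 4 gains `d⁻⁴`, which absorbs the prefactor: `2d · d⁻⁴ ≤ 1/4` once `d ≥ 2`. -/
theorem two_mul_exp_le_of_le {d : ℕ} (hd : 2 ≤ d) {a L : ℝ} (h : 4 * (Real.log d + L) ≤ a) :
    2 * (d * Real.exp (-a)) ≤ Real.exp (-(4 * L)) / 4 := by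
  have hd' : (2 : ℝ) ≤ d := by exact_mod_cast hd
  have h1 : Real.exp (-a) ≤ Real.exp (-(4 * L)) / (d : ℝ) ^ 4 := by
    rw [le_div_iff₀ (by positivity), ← Real.exp_log (by positivity : (0 : ℝ) < (d : ℝ) ^ 4),
      ← Real.exp_add, Real.log_pow]
    exact Real.exp_le_exp.mpr (by push_cast; linarith)
  have h2 : (8 : ℝ) ≤ (d : ℝ) ^ 3 := by
    calc (8 : ℝ) = 2 ^ 3 := by norm_num
      _ ≤ _ := by gcongr
  calc _ ≤ 2 * (d * (Real.exp (-(4 * L)) / (d : ℝ) ^ 4)) := by gcongr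
    _ = 2 * Real.exp (-(4 * L)) / (d : ℝ) ^ 3 := by field_simp
    _ ≤ 2 * Real.exp (-(4 * L)) / 8 := by gcongr
    _ = _ := by ring

end UniversalAttack

open UniversalAttack in
theorem theorem2 :
    ∃ C : ℝ, 0 < C ∧
      ∀ (d k : ℕ) (D : Measure (EuclideanSpace ℝ (Fin d) × Fin k)) [IsProbabilityMeasure D]
        (𝒜 : EuclideanSpace ℝ (Fin d) → EuclideanSpace ℝ (Fin d)),
        Measurable 𝒜 → (∀ᵐ z ∂D, 𝒜 z.1 ≠ 0) →
      ∀ (γ : ℝ),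
        HasTopEigengap (attackMatrix D 𝒜) (attackMatrix_isHermitian D 𝒜)
          (γ * specNorm (attackMatrix D 𝒜)) →
      ∀ (v : EuclideanSpace ℝ (Fin d)), IsTopEigenvector (attackMatrix D 𝒜) v →
      ∀ (ε : ℝ), 0 < ε → ε < γ →
      ∀ (m : ℕ) (Ω : Type*) [MeasurableSpace Ω] (P : Measure Ω) [IsProbabilityMeasure P]
        (X : Fin m → Ω → EuclideanSpace ℝ (Fin d)),
        (∀ l, HasLaw (X l) D.fst P) → iIndepFun X P →
        (C * (intrinsicDim (attackMatrix D 𝒜) * Real.log d / ε ^ 2) ≤ m →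
          P {ω | ¬ ∀ w, IsTopEigenvector (empiricalAttackMatrix 𝒜 (fun l => X l ω)) w →
              ‖v - w‖ ≤ ε / γ ∨ ‖v + w‖ ≤ ε / γ} ≤ ENNReal.ofReal (1 / 3)) ∧
        (∀ δ : ℝ, 0 < δ → δ < 1 →
          C * (intrinsicDim (attackMatrix D 𝒜) * (Real.log d + Real.log (1 / δ)) / ε ^ 2) ≤ m →
          P {ω | ¬ ∀ w, IsTopEigenvector (empiricalAttackMatrix 𝒜 (fun l => X l ω)) w →
              ‖v - w‖ ≤ ε / γ ∨ ‖v + w‖ ≤ ε / γ} ≤ ENNReal.ofReal δ) := by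
  -- `144 = 4 · 36`: the exponent `mλε²/36` must reach `4 (log d + L)`, with `L = 0` or `L =
  -- log(1/δ)`.
  refine ⟨144, by norm_num, ?_⟩
  intro d k D _ 𝒜 h𝒜 h0 γ hgap v hv ε hε hεγ m Ω _ P _ X hX hind
  have hpos := specNorm_attackMatrix_pos h𝒜 h0
  rcases Nat.lt_or_ge d 2 with hd | hd
  -- For `d = 1`, `log d = 0` and `m = 0` may be allowed, but unit vectors agree up to sign, so
  -- failure is impossible; for `d = 0` there is no unit vector `v`.
  · have hnull : P {ω | ¬ ∀ w, IsTopEigenvector (empiricalAttackMatrix 𝒜 (fun l => X l ω)) w →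
        ‖v - w‖ ≤ ε / γ ∨ ‖v + w‖ ≤ ε / γ} = 0 := by
      convert measure_empty (μ := P)
      refine Set.eq_empty_of_forall_notMem fun ω hω => hω fun w hw => ?_
      have hq : 0 ≤ ε / γ := (div_pos hε (hε.trans hεγ)).le
      interval_cases d
      · have := hv.1
        simp [Subsingleton.elim v 0] at this
      · rcases eq_or_eq_neg_of_norm_eq_one hv.1 hw.1 with h | h
        · left; simpa [h] using hq
        · right; simpa [h] using hq
    simp only [hnull, zero_le, implies_true, and_self]
  · have hmain := measure_eigenvector_far_le h𝒜 h0 (gap_le_one h𝒜 h0 hd hgap) hgap hv hε hεγ hX hind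
    rw [intrinsicDim_attackMatrix h𝒜 h0]
    have hsample : ∀ L : ℝ, 144 * ((specNorm (attackMatrix D 𝒜))⁻¹ * L / ε ^ 2) ≤ m →
        4 * L ≤ m * (specNorm (attackMatrix D 𝒜) * ε ^ 2) / 36 := fun L hL => by
      have h1 := mul_le_mul_of_nonneg_right hL
        (by positivity : 0 ≤ specNorm (attackMatrix D 𝒜) * ε ^ 2)
      have h2 : 144 * ((specNorm (attackMatrix D 𝒜))⁻¹ * L / ε ^ 2)
          * (specNorm (attackMatrix D 𝒜) * ε ^ 2) = 144 * L := by field_simp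
      linarith
    refine ⟨fun hm => hmain.trans (ENNReal.ofReal_le_ofReal ?_), fun δ hδ hδ1 hm =>
      hmain.trans (ENNReal.ofReal_le_ofReal ?_)⟩
    · refine (two_mul_exp_le_of_le hd (L := 0) (by simpa using hsample _ hm)).trans ?_
      norm_num
    · refine (two_mul_exp_le_of_le hd (hsample _ hm)).trans ?_
      have h1 : Real.exp (-(4 * Real.log (1 / δ))) = δ ^ 4 := by
        rw [one_div, Real.log_inv, ← Real.exp_log (pow_pos hδ 4), Real.log_pow]
        congr 1
        push_cast
        ring
      rw [h1]
      have h2 : δ ^ 4 ≤ δ := pow_le_of_le_one hδ.le hδ1.le (by norm_num)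
      linarith
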